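/- There is an absolute constant $C_0>0$ with the following property. Let $C,D\subseteq\{0,1,2,\dots\}$ with $D$ infinite and $$\sup_{n\in D}\operatorname{dist}(n,C)=\infty,\qquad \operatorname{dist}(n,C)=\inf_{m\in C}|n-m|$$ (with $\operatorname{dist}(n,\emptyset)=\infty$). For a set $A\subseteq\{0,1,2,\dots\}$ let $\mathcal F_A$ be the family of all dyadic rectangles $$\left[\tfrac{i-1}{2^n},\tfrac{i}{2^n}\right)\times\left[\tfrac{j-1}{2^m},\tfrac{j}{2^m}\right),\qquad n,m\in A,\ 1\le i\le 2^n,\ 1\le j\le 2^m.$$ Then for every $\varepsilon>0$ and every $M>0$ there exist a function $f\in L^\infty([0,1)^2)$ with $f\ge 0$ and $\|f\|_{L^1([0,1)^2)}\le 1$, and a measurable set $E\subseteq[0,1)^2$ with Lebesgue measure $|E|\ge 1-\varepsilon$, such that for every $z\in E$: 1. there is a rectangle $R\in\mathcal F_D$ with $z\in R$ and $\frac1{|R|}\int_R f\,dx\,dy\ge M$; 2. for every rectangle $R\in\mathcal F_C$ with $z\in R$ one has $\frac1{|R|}\int_R f\,dx\,dy\le C_0$. -/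

import Mathlib

open Set MeasureTheory

/-- The half-open unit square `[0,1)²`. -/
def unitSquare : Set (ℝ × ℝ) := Ico (0 : ℝ) 1 ×ˢ Ico (0 : ℝ) 1

/-- The dyadic rectangle `[(i-1)/2^n, i/2^n) × [(j-1)/2^m, j/2^m)`; the subtraction is real. -/
def dyadicRectangle (n m i j : ℕ) : Set (ℝ × ℝ) :=
  Ico (((i : ℝ) - 1) / 2 ^ n) ((i : ℝ) / 2 ^ n) ×ˢ Ico (((j : ℝ) - 1) / 2 ^ m) ((j : ℝ) / 2 ^ m)

/-- The family of all dyadic rectangles in `[0,1)²` with side lengths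
`2^{-n}` and `2^{-m}`, where `n, m ∈ C`. -/
def dyadicFamily (C : Set ℕ) : Set (Set (ℝ × ℝ)) :=
  {R | ∃ n ∈ C, ∃ m ∈ C, ∃ i ∈ Icc 1 (2 ^ n), ∃ j ∈ Icc 1 (2 ^ m), R = dyadicRectangle n m i j}

/-!
The constant `C₀ = 1` works. Read a point `(x, y)` of the unit square through the binary digits of
`x` and `y`: a dyadic rectangle of level `(c, d)` fixes the first `c` digits of `x` and the first
`d` digits of `y` and leaves the other digits independent and uniformly distributed.

By hypothesis there are, for every `L`, disjoint windows `[p k, p k + 2 L)` of digit positions such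
that the midpoint `p k + L` belongs to `D` while no element of `C` lies strictly inside
(`exists_windows`). So levels in `C` see all or nothing of a window, whereas `D` can see exactly
its first half. Take `N` windows, pair the window `k` of `x` with the window `N - 1 - k` of `y`, and
let `f` be the normalized indicator of the event that in each pair all the `2 L` digits agree
(`matchProduct`). The average of `f` over a rectangle `R` is the product of the normalized
indicators of those half-window matches which `R` determines on both sides, because a factor with
an undetermined side averages to one (`average_prod_matchWeight`).

* The rectangle of level `(p k + L, p (N - 1 - k) + L)` determines the match of the first halves in
  the pair `k` and nothing else; this is where the reversal of the windows of `y` is used. Its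
  average is `2 ^ L ≥ M` as soon as these halves match. The `N` events are independent of
  probability `2⁻ᴸ`, so that one of them occurs outside a set of measure `(1 - 2⁻ᴸ) ^ N`.
* A rectangle with levels in `C` determines in each pair both matches or none. So its average is
  one (an empty product) or zero, unless some pair of windows matches completely, which happens on
  a set of measure at most `N * 4⁻ᴸ`.

With `N = L * 2 ^ L` both exceptional sets are small for large `L`.
-/

open scoped ENNReal

/-! ### Dyadic intervals and blocks of binary digits -/

/-- The dyadic interval `[i/2^c, (i+1)/2^c)`, numbered from `i = 0`. -/
def dyadicInterval (c i : ℕ) : Set ℝ := Ico ((i : ℝ) / 2 ^ c) (((i : ℝ) + 1) / 2 ^ c)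

/-- The number formed by the `L` consecutive binary digits of `x ≥ 0` that occupy the positions
`s, …, s + L - 1` after the binary point (positions start at `0`). -/
noncomputable def digitBlock (L s : ℕ) (x : ℝ) : ℕ := ⌊(2 : ℝ) ^ (s + L) * x⌋₊ % 2 ^ L

theorem mem_dyadicInterval {c i : ℕ} {x : ℝ} :
    x ∈ dyadicInterval c i ↔ 0 ≤ x ∧ ⌊(2 : ℝ) ^ c * x⌋₊ = i := by
  have h2 : (0 : ℝ) < 2 ^ c := by positivity
  rw [dyadicInterval, mem_Ico, div_le_iff₀ h2, lt_div_iff₀ h2, mul_comm x]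
  constructor
  · rintro ⟨h, h'⟩
    have h0 : 0 ≤ (2 : ℝ) ^ c * x := le_trans (by positivity) h
    exact ⟨nonneg_of_mul_nonneg_right h0 h2, (Nat.floor_eq_iff h0).2 ⟨h, h'⟩⟩
  · rintro ⟨h, h'⟩
    exact (Nat.floor_eq_iff (by positivity)).1 h'

theorem floor_two_pow_mul_eq_div (c m : ℕ) (x : ℝ) :
    ⌊(2 : ℝ) ^ c * x⌋₊ = ⌊(2 : ℝ) ^ (c + m) * x⌋₊ / 2 ^ m := by
  rw [← Nat.floor_div_natCast]
  congr 1
  push_cast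
  rw [pow_add]
  field_simp

theorem measurableSet_dyadicInterval (c i : ℕ) : MeasurableSet (dyadicInterval c i) :=
  measurableSet_Ico

theorem volume_dyadicInterval (c i : ℕ) : volume (dyadicInterval c i) = ((2 : ℝ≥0∞) ^ c)⁻¹ := by
  rw [dyadicInterval, Real.volume_Ico, ← sub_div, add_sub_cancel_left, one_div,
    ENNReal.ofReal_inv_of_pos (by positivity), ENNReal.ofReal_pow (by norm_num)]
  norm_num

theorem dyadicInterval_zero_zero : dyadicInterval 0 0 = Ico (0 : ℝ) 1 := by
  simp [dyadicInterval]

theorem dyadicRectangle_eq_prod {n m i j : ℕ} (hi : 1 ≤ i) (hj : 1 ≤ j) :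
    dyadicRectangle n m i j = dyadicInterval n (i - 1) ×ˢ dyadicInterval m (j - 1) := by
  simp [dyadicRectangle, dyadicInterval, Nat.cast_sub hi, Nat.cast_sub hj]

theorem dyadicInterval_eq_biUnion (c m i : ℕ) :
    dyadicInterval c i = ⋃ r ∈ Finset.range (2 ^ m), dyadicInterval (c + m) (i * 2 ^ m + r) := by
  ext x
  have hpos : 0 < 2 ^ m := by positivity
  simp only [mem_iUnion, mem_dyadicInterval, Finset.mem_range, exists_prop,
    floor_two_pow_mul_eq_div c m]
  constructor
  · rintro ⟨h0, h⟩
    refine ⟨⌊(2 : ℝ) ^ (c + m) * x⌋₊ % 2 ^ m, Nat.mod_lt _ hpos, h0, ?_⟩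
    rw [← h, Nat.div_add_mod']
  · rintro ⟨r, hr, h0, h⟩
    refine ⟨h0, ?_⟩
    rw [h, Nat.div_eq_iff hpos]
    omega

theorem lintegral_dyadicInterval_eq_sum (c m i : ℕ) (g : ℝ → ℝ≥0∞) :
    ∫⁻ x in dyadicInterval c i, g x =
      ∑ r ∈ Finset.range (2 ^ m), ∫⁻ x in dyadicInterval (c + m) (i * 2 ^ m + r), g x := by
  rw [dyadicInterval_eq_biUnion c m i, lintegral_biUnion_finset]
  · intro r _ r' _ hne
    refine Set.disjoint_left.2 fun x hx hx' => hne ?_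
    have := (mem_dyadicInterval.1 hx).2.symm.trans (mem_dyadicInterval.1 hx').2
    omega
  · exact fun _ _ => measurableSet_dyadicInterval _ _

theorem digitBlock_lt (L s : ℕ) (x : ℝ) : digitBlock L s x < 2 ^ L :=
  Nat.mod_lt _ (by positivity)

theorem measurable_digitBlock (L s : ℕ) : Measurable (digitBlock L s) := by
  unfold digitBlock
  exact (measurable_from_top (f := fun n : ℕ => n % 2 ^ L)).comp
    (Nat.measurable_floor.comp (measurable_const.mul measurable_id))

theorem digitBlock_congr {L s c i : ℕ} (h : s + L ≤ c) {x y : ℝ} (hx : x ∈ dyadicInterval c i)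
    (hy : y ∈ dyadicInterval c i) : digitBlock L s x = digitBlock L s y := by
  obtain ⟨m, rfl⟩ := Nat.exists_eq_add_of_le h
  rw [digitBlock, digitBlock, floor_two_pow_mul_eq_div (s + L) m x,
    floor_two_pow_mul_eq_div (s + L) m y, (mem_dyadicInterval.1 hx).2, (mem_dyadicInterval.1 hy).2]

theorem sum_range_mul_mod (φ : ℕ → ℝ≥0∞) (n b : ℕ) :
    ∑ r ∈ Finset.range (n * b), φ (r % b) = n * ∑ v ∈ Finset.range b, φ v := by
  induction n with
  | zero => simp
  | succ n ih =>
    rw [add_mul, one_mul, Finset.sum_range_add, ih, Nat.cast_add, Nat.cast_one, add_mul, one_mul]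
    congr 1
    refine Finset.sum_congr rfl fun v hv => ?_
    rw [Nat.mul_add_mod_self_right, Nat.mod_eq_of_lt (Finset.mem_range.1 hv)]

/-- Disjoint blocks of binary digits are independent and uniformly distributed, also on a dyadic
interval which is so large that its points have arbitrary digits in all these blocks. -/
theorem lintegral_prod_digitBlock {ι : Type*} (L : ℕ) (s : ι → ℕ) (φ : ι → ℕ → ℝ≥0∞) (a : ℝ≥0∞)
    (Q : Finset ι)
    (hsep : ∀ q ∈ Q, ∀ q' ∈ Q, q ≠ q' → s q + L ≤ s q' ∨ s q' + L ≤ s q)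
    (hφ : ∀ q ∈ Q, ∑ v ∈ Finset.range (2 ^ L), φ q v = 2 ^ L * a) {c : ℕ} (i : ℕ)
    (hc : ∀ q ∈ Q, c ≤ s q) :
    ∫⁻ x in dyadicInterval c i, ∏ q ∈ Q, φ q (digitBlock L (s q) x) =
      ((2 : ℝ≥0∞) ^ c)⁻¹ * a ^ Q.card := by
  classical
  induction Q using Finset.induction_on_min_value s generalizing c i with
  | empty => simp [volume_dyadicInterval]
  | insert q Q hq hmin ih =>
    obtain ⟨m, hm⟩ := Nat.exists_eq_add_of_le (hc q (Finset.mem_insert_self _ _))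
    have hlevel : c + (m + L) = s q + L := by omega
    -- On a dyadic interval at the end of the coarsest block `q` the digits of this block are fixed,
    -- while the induction hypothesis applies to the other blocks.
    have hcell : ∀ r, ∫⁻ x in dyadicInterval (c + (m + L)) (i * 2 ^ (m + L) + r),
        ∏ q' ∈ insert q Q, φ q' (digitBlock L (s q') x) =
          φ q (r % 2 ^ L) * (((2 : ℝ≥0∞) ^ (s q + L))⁻¹ * a ^ Q.card) := by
      intro r
      rw [hlevel]
      rw [← ih (i := i * 2 ^ (m + L) + r) (c := s q + L), ← lintegral_const_mul]
      · refine setLIntegral_congr_fun (measurableSet_dyadicInterval _ _) fun x hx => ?_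
        have hb : digitBlock L (s q) x = r % 2 ^ L := by
          rw [digitBlock, (mem_dyadicInterval.1 hx).2, pow_add, ← mul_assoc,
            Nat.mul_add_mod_self_right]
        simp only [Finset.prod_insert hq, hb]
      · exact Finset.measurable_prod _ fun q' _ =>
          (measurable_from_top (f := φ q')).comp (measurable_digitBlock L (s q'))
      · exact fun q₁ h₁ q₂ h₂ => hsep q₁ (Finset.mem_insert_of_mem h₁) q₂
          (Finset.mem_insert_of_mem h₂)
      · exact fun q' h => hφ q' (Finset.mem_insert_of_mem h)
      · intro q' h
        have hle := hmin q' h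
        rcases hsep q (Finset.mem_insert_self _ _) q' (Finset.mem_insert_of_mem h)
          (by rintro rfl; exact hq h) with h' | h' <;> omega
    rw [lintegral_dyadicInterval_eq_sum c (m + L) i]
    simp only [hcell]
    rw [← Finset.sum_mul, pow_add, sum_range_mul_mod, hφ q (Finset.mem_insert_self _ _),
      Finset.card_insert_of_notMem hq, hm, pow_add, pow_add, pow_succ]
    have h2 : ∀ n : ℕ, (2 : ℝ≥0∞) ^ n ≠ 0 := fun n => by simp
    have h2' : ∀ n : ℕ, (2 : ℝ≥0∞) ^ n ≠ ⊤ := fun n => by simp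
    rw [ENNReal.mul_inv (.inr (h2' _)) (.inr (h2 _)), ENNReal.mul_inv (.inr (h2' _)) (.inr (h2 _))]
    push_cast
    calc (2 : ℝ≥0∞) ^ m * (2 ^ L * a) * ((2 ^ c)⁻¹ * (2 ^ m)⁻¹ * (2 ^ L)⁻¹ * a ^ Q.card)
        = (2 ^ m * (2 ^ m)⁻¹) * (2 ^ L * (2 ^ L)⁻¹) * ((2 ^ c)⁻¹ * (a ^ Q.card * a)) := by ring
      _ = _ := by
        rw [ENNReal.mul_inv_cancel (h2 _) (h2' _), ENNReal.mul_inv_cancel (h2 _) (h2' _)]; ring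

/-! ### Matching blocks of digits of the two coordinates -/

/-- The normalized indicator `2^L · 1{b_s(x) = b_t(y)}` of the event that the digits of `x` in
positions `s, …, s + L - 1` agree with the digits of `y` in positions `t, …, t + L - 1`. It has mean
one in either variable when the other one is fixed. -/
noncomputable def matchWeight (L s t : ℕ) (z : ℝ × ℝ) : ℝ≥0∞ :=
  if digitBlock L s z.1 = digitBlock L t z.2 then 2 ^ L else 0

theorem measurableSet_digitBlock_eq (L s t : ℕ) :
    MeasurableSet {z : ℝ × ℝ | digitBlock L s z.1 = digitBlock L t z.2} :=
  measurableSet_eq_fun ((measurable_digitBlock L s).comp measurable_fst)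
    ((measurable_digitBlock L t).comp measurable_snd)

theorem measurable_matchWeight (L s t : ℕ) : Measurable (matchWeight L s t) :=
  Measurable.ite (measurableSet_digitBlock_eq L s t) measurable_const measurable_const

theorem matchWeight_le (L s t : ℕ) (z : ℝ × ℝ) : matchWeight L s t z ≤ 2 ^ L := by
  unfold matchWeight
  split_ifs <;> simp

theorem measurable_prod_matchWeight {ι : Type*} (L : ℕ) (s t : ι → ℕ) (Q : Finset ι) :
    Measurable fun z => ∏ q ∈ Q, matchWeight L (s q) (t q) z :=
  Finset.measurable_prod _ fun q _ => measurable_matchWeight L (s q) (t q)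

theorem prod_matchWeight_le {ι : Type*} (L : ℕ) (s t : ι → ℕ) (Q : Finset ι) (z : ℝ × ℝ) :
    ∏ q ∈ Q, matchWeight L (s q) (t q) z ≤ (2 ^ L) ^ Q.card :=
  Finset.prod_le_pow_card _ _ _ fun q _ => matchWeight_le L (s q) (t q) z

theorem prod_matchWeight_lt_top {ι : Type*} (L : ℕ) (s t : ι → ℕ) (Q : Finset ι) (z : ℝ × ℝ) :
    ∏ q ∈ Q, matchWeight L (s q) (t q) z < ⊤ :=
  (prod_matchWeight_le L s t Q z).trans_lt (by finiteness)

/-- Averaging a product of normalized digit indicators over a dyadic interval keeps the factors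
that are constant on the interval and replaces the other ones by their mean, which is one. -/
theorem lintegral_prod_ite_digitBlock {ι : Type*} (L : ℕ) (t : ι → ℕ) (u : ι → ℕ) (Q : Finset ι)
    (ht : ∀ q ∈ Q, ∀ q' ∈ Q, q ≠ q' → t q + L ≤ t q' ∨ t q' + L ≤ t q)
    (hu : ∀ q ∈ Q, u q < 2 ^ L) {d j : ℕ} (hd : ∀ q ∈ Q, t q < d → t q + L ≤ d)
    {y₀ : ℝ} (hy₀ : y₀ ∈ dyadicInterval d j) :
    ∫⁻ y in dyadicInterval d j, ∏ q ∈ Q, (if u q = digitBlock L (t q) y then (2 : ℝ≥0∞) ^ L else 0)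
      = ((2 : ℝ≥0∞) ^ d)⁻¹ *
        ∏ q ∈ Q with t q < d, (if u q = digitBlock L (t q) y₀ then (2 : ℝ≥0∞) ^ L else 0) := by
  have hfine := lintegral_prod_digitBlock L t (fun q v => if u q = v then (2 : ℝ≥0∞) ^ L else 0) 1
    (Q.filter fun q => ¬ t q < d)
    (fun q hq q' hq' => ht q (Finset.mem_filter.1 hq).1 q' (Finset.mem_filter.1 hq').1)
    (fun q hq => by simp [hu q (Finset.mem_filter.1 hq).1]) (c := d) j
    (fun q hq => not_lt.1 (Finset.mem_filter.1 hq).2)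
  rw [one_pow, mul_one] at hfine
  rw [← hfine, mul_comm, ← lintegral_const_mul]
  · refine setLIntegral_congr_fun (measurableSet_dyadicInterval _ _) fun y hy => ?_
    rw [← Finset.prod_filter_mul_prod_filter_not Q fun q => t q < d]
    congr 1
    refine Finset.prod_congr rfl fun q hq => ?_
    obtain ⟨hq, hlt⟩ := Finset.mem_filter.1 hq
    rw [digitBlock_congr (hd q hq hlt) hy hy₀]
  · exact Finset.measurable_prod _ fun q _ =>
      (measurable_from_top (f := fun v => if u q = v then (2 : ℝ≥0∞) ^ L else 0)).comp
        (measurable_digitBlock L (t q))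

/-- The average of a product of match weights over a dyadic rectangle of level `(c, d)` is the
product of those weights for which both blocks of digits are determined by the rectangle. A pair
with at least one undetermined block averages to one. -/
theorem lintegral_prod_matchWeight {ι : Type*} (L : ℕ) (s t : ι → ℕ) (Q : Finset ι)
    (hs : ∀ q ∈ Q, ∀ q' ∈ Q, q ≠ q' → s q + L ≤ s q' ∨ s q' + L ≤ s q)
    (ht : ∀ q ∈ Q, ∀ q' ∈ Q, q ≠ q' → t q + L ≤ t q' ∨ t q' + L ≤ t q)
    {c d i j : ℕ} (hc : ∀ q ∈ Q, s q < c → s q + L ≤ c) (hd : ∀ q ∈ Q, t q < d → t q + L ≤ d)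
    {z : ℝ × ℝ} (hz : z ∈ dyadicInterval c i ×ˢ dyadicInterval d j) :
    ∫⁻ w in dyadicInterval c i ×ˢ dyadicInterval d j, ∏ q ∈ Q, matchWeight L (s q) (t q) w =
      ((2 : ℝ≥0∞) ^ c)⁻¹ * ((2 : ℝ≥0∞) ^ d)⁻¹ *
        ∏ q ∈ Q with s q < c ∧ t q < d, matchWeight L (s q) (t q) z := by
  rw [Measure.volume_eq_prod, ← Measure.prod_restrict, lintegral_prod]
  · have hinner := fun x : ℝ => lintegral_prod_ite_digitBlock L t (fun q => digitBlock L (s q) x) Q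
      ht (fun q _ => digitBlock_lt L (s q) x) hd hz.2
    simp only [matchWeight, hinner]
    rw [lintegral_const_mul' _ _ (by simp)]
    have houter := lintegral_prod_ite_digitBlock L s (fun q => digitBlock L (t q) z.2)
      (Q.filter fun q => t q < d)
      (fun q hq q' hq' => hs q (Finset.mem_filter.1 hq).1 q' (Finset.mem_filter.1 hq').1)
      (fun q _ => digitBlock_lt L (t q) z.2) (fun q hq => hc q (Finset.mem_filter.1 hq).1) hz.1
    simp only [eq_comm (a := digitBlock L (t _) z.2)] at houter
    rw [houter, Finset.filter_filter, ← mul_assoc, mul_comm (((2 : ℝ≥0∞) ^ d)⁻¹)]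
    simp only [and_comm]
  · exact (measurable_prod_matchWeight L s t Q).aemeasurable

theorem average_prod_matchWeight {ι : Type*} (L : ℕ) (s t : ι → ℕ) (Q : Finset ι)
    (hs : ∀ q ∈ Q, ∀ q' ∈ Q, q ≠ q' → s q + L ≤ s q' ∨ s q' + L ≤ s q)
    (ht : ∀ q ∈ Q, ∀ q' ∈ Q, q ≠ q' → t q + L ≤ t q' ∨ t q' + L ≤ t q)
    {c d i j : ℕ} (hc : ∀ q ∈ Q, s q < c → s q + L ≤ c) (hd : ∀ q ∈ Q, t q < d → t q + L ≤ d)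
    {z : ℝ × ℝ} (hz : z ∈ dyadicInterval c i ×ˢ dyadicInterval d j) :
    ⨍ w in dyadicInterval c i ×ˢ dyadicInterval d j,
        (∏ q ∈ Q, matchWeight L (s q) (t q) w).toReal =
      (∏ q ∈ Q with s q < c ∧ t q < d, matchWeight L (s q) (t q) z).toReal := by
  rw [← toReal_setLAverage (measurable_prod_matchWeight L s t Q).aemeasurable
    (.of_forall fun w => (prod_matchWeight_lt_top L s t Q w).ne), setLAverage_eq,
    lintegral_prod_matchWeight L s t Q hs ht hc hd hz, Measure.volume_eq_prod,
    Measure.prod_prod, volume_dyadicInterval, volume_dyadicInterval, mul_comm,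
    ENNReal.mul_div_cancel_right]
  · exact mul_ne_zero (by simp) (by simp)
  · exact ENNReal.mul_ne_top (by simp) (by simp)

/-- The blocks of `x` and of `y` with a common index all differ with the same probability as for
independent uniformly distributed blocks. -/
theorem volume_forall_digitBlock_ne {ι : Type*} (L : ℕ) (s t : ι → ℕ) (Q : Finset ι)
    (ht : ∀ q ∈ Q, ∀ q' ∈ Q, q ≠ q' → t q + L ≤ t q' ∨ t q' + L ≤ t q) :
    volume.restrict unitSquare {z | ∀ q ∈ Q, digitBlock L (s q) z.1 ≠ digitBlock L (t q) z.2} =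
      (1 - ((2 : ℝ≥0∞) ^ L)⁻¹) ^ Q.card := by
  have hmeas : MeasurableSet
      {z : ℝ × ℝ | ∀ q ∈ Q, digitBlock L (s q) z.1 ≠ digitBlock L (t q) z.2} := by
    simp only [ofPred_forall]
    exact Finset.measurableSet_biInter Q fun q _ =>
      (measurableSet_digitBlock_eq L (s q) (t q)).compl
  have hind : ∀ z : ℝ × ℝ,
      {z : ℝ × ℝ | ∀ q ∈ Q, digitBlock L (s q) z.1 ≠ digitBlock L (t q) z.2}.indicator 1 z =
        ∏ q ∈ Q, (if digitBlock L (s q) z.1 = digitBlock L (t q) z.2 then (0 : ℝ≥0∞) else 1) := by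
    intro z
    by_cases h : ∀ q ∈ Q, digitBlock L (s q) z.1 ≠ digitBlock L (t q) z.2
    · rw [indicator_of_mem (by exact h), Finset.prod_eq_one fun q hq => if_neg (h q hq),
        Pi.one_apply]
    · rw [indicator_of_notMem (by exact h)]
      push Not at h
      obtain ⟨q, hq, he⟩ := h
      exact Eq.symm (Finset.prod_eq_zero (i := q) hq (by rw [if_pos he]))
  have hinner : ∀ x : ℝ, ∫⁻ y in Ico (0 : ℝ) 1,
      ∏ q ∈ Q, (if digitBlock L (s q) x = digitBlock L (t q) y then (0 : ℝ≥0∞) else 1) =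
        (1 - ((2 : ℝ≥0∞) ^ L)⁻¹) ^ Q.card := by
    intro x
    have h := lintegral_prod_digitBlock L t
      (fun q v => if digitBlock L (s q) x = v then (0 : ℝ≥0∞) else 1) (1 - ((2 : ℝ≥0∞) ^ L)⁻¹) Q ht
      (fun q _ => ?_) (c := 0) 0 (fun q _ => Nat.zero_le _)
    · rwa [dyadicInterval_zero_zero, pow_zero, inv_one, one_mul] at h
    · rw [ENNReal.mul_sub (by simp), mul_one, ENNReal.mul_inv_cancel (by simp) (by simp),
        Finset.sum_ite, Finset.sum_const_zero, zero_add, Finset.sum_const, nsmul_one,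
        Finset.filter_not, Finset.filter_eq,
        if_pos (Finset.mem_range.2 (digitBlock_lt L (s q) x)), Finset.card_sdiff_of_subset
          (by simpa using digitBlock_lt L (s q) x), Finset.card_range, Finset.card_singleton,
        ENNReal.natCast_sub]
      push_cast
      rfl
  rw [← lintegral_indicator_one hmeas, unitSquare, Measure.volume_eq_prod, ← Measure.prod_restrict,
    lintegral_prod _ (measurable_one.indicator hmeas).aemeasurable]
  simp only [hind, hinner]
  simp

theorem volume_unitSquare : volume unitSquare = 1 := by
  simp [unitSquare, Measure.volume_eq_prod]

theorem lintegral_unitSquare_prod_matchWeight {ι : Type*} (L : ℕ) (s t : ι → ℕ) (Q : Finset ι)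
    (hs : ∀ q ∈ Q, ∀ q' ∈ Q, q ≠ q' → s q + L ≤ s q' ∨ s q' + L ≤ s q)
    (ht : ∀ q ∈ Q, ∀ q' ∈ Q, q ≠ q' → t q + L ≤ t q' ∨ t q' + L ≤ t q) :
    ∫⁻ w in unitSquare, ∏ q ∈ Q, matchWeight L (s q) (t q) w = 1 := by
  have h := lintegral_prod_matchWeight L s t Q hs ht (c := 0) (d := 0) (i := 0) (j := 0) (z := 0)
    (by simp) (by simp) (by simp [dyadicInterval_zero_zero])
  simpa [dyadicInterval_zero_zero, unitSquare] using h

theorem volume_forall_digitBlock_eq_le {ι : Type*} (L : ℕ) (s t : ι → ℕ) (Q : Finset ι)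
    (hs : ∀ q ∈ Q, ∀ q' ∈ Q, q ≠ q' → s q + L ≤ s q' ∨ s q' + L ≤ s q)
    (ht : ∀ q ∈ Q, ∀ q' ∈ Q, q ≠ q' → t q + L ≤ t q' ∨ t q' + L ≤ t q) :
    volume.restrict unitSquare {z | ∀ q ∈ Q, digitBlock L (s q) z.1 = digitBlock L (t q) z.2} ≤
      (((2 : ℝ≥0∞) ^ L) ^ Q.card)⁻¹ := by
  have h := meas_ge_le_lintegral_div (μ := volume.restrict unitSquare)
    (measurable_prod_matchWeight L s t Q).aemeasurable
    (ε := ((2 : ℝ≥0∞) ^ L) ^ Q.card) (by simp) (by finiteness)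
  rw [lintegral_unitSquare_prod_matchWeight L s t Q hs ht, one_div] at h
  refine (measure_mono fun z hz => ?_).trans h
  change ∀ q ∈ Q, digitBlock L (s q) z.1 = digitBlock L (t q) z.2 at hz
  change _ ≤ ∏ q ∈ Q, matchWeight L (s q) (t q) z
  exact Finset.pow_card_le_prod _ _ _ fun q hq => (if_pos (hz q hq)).ge

/-! ### Choice of scales -/

theorem Nat.edist_le_of_le_add {m n K : ℕ} (h : m ≤ n + K) (h' : n ≤ m + K) :
    edist m n ≤ (K : ℝ≥0∞) := by
  rw [edist_dist, Nat.dist_eq, ← ENNReal.ofReal_natCast]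
  refine ENNReal.ofReal_le_ofReal (abs_sub_le_iff.2 ⟨?_, ?_⟩) <;>
  · rw [sub_le_iff_le_add']
    exact_mod_cast ‹_›

theorem exists_mem_far {C D : Set ℕ} (hD : D.Infinite)
    (hsup : (⨆ n ∈ D, Metric.infEDist n C) = ⊤) (T L : ℕ) :
    ∃ n ∈ D, T ≤ n ∧ ∀ c ∈ C, c + L ≤ n ∨ n + L ≤ c := by
  rcases C.eq_empty_or_nonempty with rfl | ⟨c₀, hc₀⟩
  · obtain ⟨n, hn, hT⟩ := hD.exists_gt T
    exact ⟨n, hn, hT.le, by simp⟩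
  by_contra! hcon
  refine (ENNReal.natCast_ne_top (L + T + c₀)) (top_unique (hsup ▸ iSup₂_le fun n hn => ?_))
  rcases lt_or_ge n T with hT | hT
  · exact (Metric.infEDist_le_edist_of_mem hc₀).trans
      (Nat.edist_le_of_le_add (by omega) (by omega))
  · obtain ⟨c, hc, h, h'⟩ := hcon n hn hT
    exact (Metric.infEDist_le_edist_of_mem hc).trans
      (Nat.edist_le_of_le_add (by omega) (by omega))

/-- There are consecutive windows `[p k, p k + 2 L]` of levels whose midpoints belong to `D` and
whose interiors do not meet `C`. -/
theorem exists_windows {C D : Set ℕ} (hD : D.Infinite)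
    (hsup : (⨆ n ∈ D, Metric.infEDist n C) = ⊤) (L : ℕ) :
    ∃ p : ℕ → ℕ, (∀ k, p k + L ∈ D) ∧ (∀ k, ∀ c ∈ C, c ≤ p k ∨ p k + 2 * L ≤ c) ∧
      ∀ k l, k < l → p k + 2 * L ≤ p l := by
  have hfar : ∀ T, ∃ a, T ≤ a ∧ a + L ∈ D ∧ ∀ c ∈ C, c ≤ a ∨ a + 2 * L ≤ c := by
    intro T
    obtain ⟨n, hn, hT, hC⟩ := exists_mem_far hD hsup (T + L) L
    refine ⟨n - L, by omega, by rwa [Nat.sub_add_cancel (by omega)], fun c hc => ?_⟩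
    rcases hC c hc with h | h <;> omega
  choose F hF using hfar
  let p : ℕ → ℕ := fun k => Nat.rec (F 0) (fun _ a => F (a + 2 * L)) k
  have hp : ∀ k, p (k + 1) = F (p k + 2 * L) := fun _ => rfl
  have hstep : ∀ k, p k + 2 * L ≤ p (k + 1) := fun k => hp k ▸ (hF _).1
  refine ⟨p, fun k => ?_, fun k => ?_, fun k l hkl => ?_⟩
  · cases k with
    | zero => exact (hF 0).2.1
    | succ k => exact (hF _).2.1
  · cases k with
    | zero => exact (hF 0).2.2
    | succ k => exact (hF _).2.2
  · exact (hstep k).trans (monotone_nat_of_le_succ (fun k => by have := hstep k; omega) hkl)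

theorem exists_parameter (ε : ℝ) (hε : 0 < ε) (M : ℝ) :
    ∃ L : ℕ, 1 ≤ L ∧ M ≤ 2 ^ L ∧
      (1 - ((2 : ℝ≥0∞) ^ L)⁻¹) ^ (L * 2 ^ L) + ((L * 2 ^ L : ℕ) : ℝ≥0∞) * (((2 : ℝ≥0∞) ^ L) ^ 2)⁻¹ ≤
        ENNReal.ofReal ε := by
  have h1 : Filter.Tendsto (fun L : ℕ => (L : ℝ) ^ 1 * (1 / 2 : ℝ) ^ L) Filter.atTop (nhds 0) :=
    tendsto_pow_const_mul_const_pow_of_abs_lt_one 1 (by rw [abs_of_pos] <;> norm_num)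
  have h2 : Filter.Tendsto (fun L : ℕ => Real.exp (-(L : ℝ))) Filter.atTop (nhds 0) :=
    Real.tendsto_exp_neg_atTop_nhds_zero.comp tendsto_natCast_atTop_atTop
  have h3 : Filter.Tendsto (fun L : ℕ => (2 : ℝ) ^ L) Filter.atTop Filter.atTop :=
    tendsto_pow_atTop_atTop_of_one_lt (by norm_num)
  obtain ⟨L, hL1, hL2, hL3, hL4⟩ := ((h1.eventually_lt_const (half_pos hε)).and
    ((h2.eventually_lt_const (half_pos hε)).and
      ((h3.eventually_ge_atTop M).and (Filter.eventually_ge_atTop 1)))).exists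
  refine ⟨L, hL4, hL3, ?_⟩
  have hpow : ((2 : ℝ≥0∞) ^ L) = ENNReal.ofReal (2 ^ L) := by
    rw [ENNReal.ofReal_pow (by norm_num)]; norm_num
  have hle1 : ((2 : ℝ) ^ L)⁻¹ ≤ 1 := inv_le_one_of_one_le₀ (one_le_pow₀ (by norm_num))
  have hreal1 : (1 - ((2 : ℝ) ^ L)⁻¹) ^ (L * 2 ^ L) ≤ Real.exp (-(L : ℝ)) := by
    refine (pow_le_pow_left₀ (by linarith) (Real.one_sub_le_exp_neg _) _).trans_eq ?_
    rw [← Real.exp_nat_mul]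
    congr 1
    push_cast
    field_simp
  have hreal2 : ((L * 2 ^ L : ℕ) : ℝ) * (((2 : ℝ) ^ L) ^ 2)⁻¹ = (L : ℝ) ^ 1 * (1 / 2 : ℝ) ^ L := by
    push_cast
    rw [one_div, inv_pow]
    field_simp
  rw [hpow, ← ENNReal.ofReal_inv_of_pos (by positivity), ← ENNReal.ofReal_one,
    ← ENNReal.ofReal_sub _ (by positivity), ← ENNReal.ofReal_pow (by linarith),
    ← ENNReal.ofReal_pow (by positivity), ← ENNReal.ofReal_inv_of_pos (by positivity),
    ← ENNReal.ofReal_natCast, ← ENNReal.ofReal_mul (by positivity),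
    ← ENNReal.ofReal_add (pow_nonneg (by linarith) _) (by positivity)]
  refine ENNReal.ofReal_le_ofReal ?_
  rw [hreal2]
  linarith

/-! ### The extremal function -/

/-- The two adjacent blocks of length `L` that fill the window starting at `p k`: the index
`(k, false)` stands for the first one and `(k, true)` for the second one. -/
def blockStart (L : ℕ) (p : ℕ → ℕ) (q : ℕ × Bool) : ℕ := p q.1 + q.2.toNat * L

/-- The start of the block of `y` which is matched with the block `q` of `x`: the order of the `N`
windows is reversed, the order inside a window is kept. -/
def partnerStart (L : ℕ) (p : ℕ → ℕ) (N : ℕ) (q : ℕ × Bool) : ℕ :=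
  blockStart L p (N - 1 - q.1, q.2)

theorem blockStart_separated {L : ℕ} {p : ℕ → ℕ} (hp : ∀ k l, k < l → p k + 2 * L ≤ p l)
    {q q' : ℕ × Bool} (hne : q ≠ q') :
    blockStart L p q + L ≤ blockStart L p q' ∨ blockStart L p q' + L ≤ blockStart L p q := by
  obtain ⟨k, e⟩ := q
  obtain ⟨l, e'⟩ := q'
  rcases lt_trichotomy k l with h | rfl | h
  · have := hp k l h
    cases e <;> cases e' <;> simp [blockStart] <;> omega
  · cases e <;> cases e' <;> simp_all [blockStart]
  · have := hp l k h
    cases e <;> cases e' <;> simp [blockStart] <;> omega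

theorem partnerStart_separated {L N : ℕ} {p : ℕ → ℕ} (hp : ∀ k l, k < l → p k + 2 * L ≤ p l)
    {q q' : ℕ × Bool} (hq : q.1 < N) (hq' : q'.1 < N) (hne : q ≠ q') :
    partnerStart L p N q + L ≤ partnerStart L p N q' ∨
      partnerStart L p N q' + L ≤ partnerStart L p N q := by
  refine blockStart_separated hp fun h => hne ?_
  rw [Prod.mk.injEq] at h
  exact Prod.ext (by omega) h.2

/-- A level outside the interiors of the windows does not cut a block, and it lies above the whole
window as soon as it lies above the start of one of its blocks. -/
theorem window_le_of_blockStart_lt {L c : ℕ} {p : ℕ → ℕ} {q : ℕ × Bool}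
    (hc : c ≤ p q.1 ∨ p q.1 + 2 * L ≤ c) (h : blockStart L p q < c) : p q.1 + 2 * L ≤ c := by
  rcases hc with hc | hc
  · have : p q.1 ≤ blockStart L p q := Nat.le_add_right _ _
    omega
  · exact hc

theorem blockStart_add_le (L : ℕ) (p : ℕ → ℕ) (q : ℕ × Bool) :
    blockStart L p q + L ≤ p q.1 + 2 * L := by
  obtain ⟨k, e⟩ := q
  cases e <;> simp [blockStart] <;> omega

theorem blockStart_lt_midpoint_iff {L : ℕ} (hL : 1 ≤ L) {p : ℕ → ℕ}
    (hp : ∀ k l, k < l → p k + 2 * L ≤ p l) {q : ℕ × Bool} {k : ℕ} :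
    blockStart L p q < p k + L ↔ q.1 < k ∨ q = (k, false) := by
  obtain ⟨l, e⟩ := q
  rcases lt_trichotomy k l with h | rfl | h
  · have := hp k l h
    cases e <;> simp [blockStart] <;> omega
  · cases e <;> simp [blockStart] ; omega
  · have := hp l k h
    cases e <;> simp [blockStart] <;> omega

theorem blockStart_add_le_midpoint {L : ℕ} (hL : 1 ≤ L) {p : ℕ → ℕ}
    (hp : ∀ k l, k < l → p k + 2 * L ≤ p l) {q : ℕ × Bool} {k : ℕ}
    (h : blockStart L p q < p k + L) : blockStart L p q + L ≤ p k + L := by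
  rcases (blockStart_lt_midpoint_iff hL hp).1 h with h | rfl
  · have := hp _ _ h
    have := blockStart_add_le L p q
    omega
  · simp [blockStart]

/-- The index set of the blocks in the first `N` windows. -/
def blockIndices (N : ℕ) : Finset (ℕ × Bool) := Finset.range N ×ˢ Finset.univ

theorem mem_blockIndices {N : ℕ} {q : ℕ × Bool} : q ∈ blockIndices N ↔ q.1 < N := by
  simp [blockIndices]

/-- The product of the normalized indicators that the block `(k, e)` of `x` agrees with the block
`(N - 1 - k, e)` of `y`, over all `k < N` and both blocks `e` of a window. -/
noncomputable def matchProduct (L : ℕ) (p : ℕ → ℕ) (N : ℕ) (z : ℝ × ℝ) : ℝ≥0∞ :=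
  ∏ q ∈ blockIndices N, matchWeight L (blockStart L p q) (partnerStart L p N q) z

theorem exists_mem_dyadicInterval {x : ℝ} (hx : x ∈ Ico (0 : ℝ) 1) (n : ℕ) :
    ∃ i ∈ Icc 1 (2 ^ n), x ∈ dyadicInterval n (i - 1) := by
  refine ⟨⌊(2 : ℝ) ^ n * x⌋₊ + 1, ⟨by omega, ?_⟩, mem_dyadicInterval.2 ⟨hx.1, rfl⟩⟩
  rw [Nat.add_one_le_iff, Nat.floor_lt (mul_nonneg (by positivity) hx.1)]
  push_cast
  exact mul_lt_of_lt_one_right (by positivity) hx.2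

/-- On the rectangles whose levels are midpoints of opposite windows, the only match that is
determined is that of the first blocks of these windows. -/
theorem average_matchProduct_midpoint {L N k i j : ℕ} (hL : 1 ≤ L) {p : ℕ → ℕ}
    (hp : ∀ k l, k < l → p k + 2 * L ≤ p l) (hk : k < N) {z : ℝ × ℝ}
    (hz : z ∈ dyadicInterval (p k + L) i ×ˢ dyadicInterval (p (N - 1 - k) + L) j)
    (hmatch : digitBlock L (blockStart L p (k, false)) z.1 =
      digitBlock L (partnerStart L p N (k, false)) z.2) :
    ⨍ w in dyadicInterval (p k + L) i ×ˢ dyadicInterval (p (N - 1 - k) + L) j,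
      (matchProduct L p N w).toReal = 2 ^ L := by
  unfold matchProduct
  rw [average_prod_matchWeight L _ _ _ (fun q _ q' _ => blockStart_separated hp)
    (fun q hq q' hq' => partnerStart_separated hp (mem_blockIndices.1 hq) (mem_blockIndices.1 hq'))
    (fun q _ => blockStart_add_le_midpoint hL hp) (fun q _ => blockStart_add_le_midpoint hL hp) hz]
  have hseen : (blockIndices N).filter (fun q => blockStart L p q < p k + L ∧
      partnerStart L p N q < p (N - 1 - k) + L) = {(k, false)} := by
    ext ⟨l, e⟩
    rw [Finset.mem_filter, partnerStart, blockStart_lt_midpoint_iff hL hp,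
      blockStart_lt_midpoint_iff hL hp, mem_blockIndices, Finset.mem_singleton]
    simp only [Prod.mk.injEq]
    cases e <;> simp <;> omega
  rw [hseen, Finset.prod_singleton, matchWeight, if_pos hmatch]
  simp

/-- A rectangle whose levels avoid the interiors of the windows determines, for each `k`, either
both matches or none between the windows `k` and `N - 1 - k`. Where these do not both hold for any
`k`, the average is therefore an empty product or zero. -/
theorem average_matchProduct_le_one {L N c d i j : ℕ} {p : ℕ → ℕ}
    (hp : ∀ k l, k < l → p k + 2 * L ≤ p l) (hc : ∀ k, c ≤ p k ∨ p k + 2 * L ≤ c)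
    (hd : ∀ k, d ≤ p k ∨ p k + 2 * L ≤ d) (hL : 1 ≤ L) {z : ℝ × ℝ}
    (hz : z ∈ dyadicInterval c i ×ˢ dyadicInterval d j)
    (hmatch : ∀ k < N, ¬ ∀ q ∈ ({k} ×ˢ Finset.univ : Finset (ℕ × Bool)),
      digitBlock L (blockStart L p q) z.1 = digitBlock L (partnerStart L p N q) z.2) :
    ⨍ w in dyadicInterval c i ×ˢ dyadicInterval d j, (matchProduct L p N w).toReal ≤ 1 := by
  unfold matchProduct
  rw [average_prod_matchWeight L _ _ _ (fun q _ q' _ => blockStart_separated hp)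
    (fun q hq q' hq' => partnerStart_separated hp (mem_blockIndices.1 hq) (mem_blockIndices.1 hq'))
    (fun q _ h => (blockStart_add_le L p q).trans (window_le_of_blockStart_lt (hc _) h))
    (fun q _ h => (blockStart_add_le L p _).trans (window_le_of_blockStart_lt (hd _) h)) hz]
  rcases Finset.eq_empty_or_nonempty ((blockIndices N).filter fun q => blockStart L p q < c ∧
      partnerStart L p N q < d) with h | ⟨⟨k, e⟩, h⟩
  · simp [h]
  · rw [Finset.mem_filter, mem_blockIndices] at h
    obtain ⟨hk, hkc, hkd⟩ := h
    have hkc' := window_le_of_blockStart_lt (hc _) hkc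
    have hkd' := window_le_of_blockStart_lt (hd _) hkd
    have hno := hmatch k hk
    push Not at hno
    obtain ⟨⟨l, e'⟩, hl, hne⟩ := hno
    obtain rfl : l = k := Finset.mem_singleton.1 (Finset.mem_product.1 hl).1
    rw [Finset.prod_eq_zero (i := (l, e')) _ (if_neg hne)]
    · simp
    · rw [Finset.mem_filter, mem_blockIndices]
      have h1 := blockStart_add_le L p (l, e')
      have h2 := blockStart_add_le L p (N - 1 - l, e')
      dsimp only at hkc' hkd' h1 h2
      exact ⟨hk, by omega, by rw [partnerStart]; dsimp only; omega⟩

/-! ### Divergence along `D` with bounded averages along `C` -/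

theorem mainTheorem3 :
    ∃ C₀ : ℝ, 0 < C₀ ∧
      ∀ C D : Set ℕ, D.Infinite → (⨆ n ∈ D, Metric.infEDist n C) = ⊤ →
        ∀ ε : ℝ, 0 < ε → ∀ M : ℝ, 0 < M →
          ∃ f : ℝ × ℝ → ℝ,
            MemLp f ⊤ (volume.restrict unitSquare) ∧
            (∀ z, 0 ≤ f z) ∧
            eLpNorm f 1 (volume.restrict unitSquare) ≤ 1 ∧
            ∃ E : Set (ℝ × ℝ), E ⊆ unitSquare ∧ MeasurableSet E ∧
              ENNReal.ofReal (1 - ε) ≤ volume E ∧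
              ∀ z ∈ E,
                (∃ R ∈ dyadicFamily D, z ∈ R ∧ M ≤ ⨍ w in R, f w) ∧
                (∀ R ∈ dyadicFamily C, z ∈ R → (⨍ w in R, f w) ≤ C₀) := by
  refine ⟨1, one_pos, fun C D hD hsup ε hε M _ => ?_⟩
  obtain ⟨L, hL, hM, hmeas⟩ := exists_parameter ε hε M
  obtain ⟨p, hpD, hpC, hp⟩ := exists_windows hD hsup L
  set N := L * 2 ^ L
  have hfm : Measurable (matchProduct L p N) := measurable_prod_matchWeight L _ _ _
  have hft : ∀ z, matchProduct L p N z < ⊤ := prod_matchWeight_lt_top L _ _ _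
  -- The points at which no two first blocks match, and those at which two whole windows match.
  set B₁ : Set (ℝ × ℝ) := {z | ∀ k ∈ Finset.range N, digitBlock L (blockStart L p (k, false)) z.1 ≠
    digitBlock L (partnerStart L p N (k, false)) z.2}
  set B₂ : Set (ℝ × ℝ) := ⋃ k ∈ Finset.range N,
    {z | ∀ q ∈ ({k} ×ˢ Finset.univ : Finset (ℕ × Bool)),
      digitBlock L (blockStart L p q) z.1 = digitBlock L (partnerStart L p N q) z.2}
  have hB₁m : MeasurableSet B₁ := by
    simp only [B₁, ofPred_forall]
    exact Finset.measurableSet_biInter _ fun q _ => (measurableSet_digitBlock_eq L _ _).compl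
  have hB₂m : MeasurableSet B₂ := by
    simp only [B₂, ofPred_forall]
    exact Finset.measurableSet_biUnion _ fun k _ =>
      Finset.measurableSet_biInter _ fun q _ => measurableSet_digitBlock_eq L _ _
  have hB₁ : volume.restrict unitSquare B₁ = (1 - ((2 : ℝ≥0∞) ^ L)⁻¹) ^ N := by
    have h := volume_forall_digitBlock_ne L (fun k => blockStart L p (k, false))
      (fun k => partnerStart L p N (k, false)) (Finset.range N) fun q hq q' hq' hne =>
        partnerStart_separated hp (Finset.mem_range.1 hq) (Finset.mem_range.1 hq')
          (by simpa using hne)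
    rwa [Finset.card_range] at h
  have hB₂ : volume.restrict unitSquare B₂ ≤ (N : ℝ≥0∞) * (((2 : ℝ≥0∞) ^ L) ^ 2)⁻¹ := by
    refine (measure_biUnion_finset_le _ _).trans ((Finset.sum_le_card_nsmul _ _
      (((2 : ℝ≥0∞) ^ L) ^ 2)⁻¹ fun k hk => ?_).trans_eq ?_)
    · have hmem : ∀ q ∈ ({k} ×ˢ Finset.univ : Finset (ℕ × Bool)), q.1 < N := by
        intro q hq
        rw [Finset.mem_product, Finset.mem_singleton] at hq
        exact hq.1 ▸ Finset.mem_range.1 hk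
      have h := volume_forall_digitBlock_eq_le L (blockStart L p) (partnerStart L p N)
        ({k} ×ˢ Finset.univ) (fun q _ q' _ => blockStart_separated hp)
        fun q hq q' hq' => partnerStart_separated hp (hmem q hq) (hmem q' hq')
      rwa [Finset.card_product, Finset.card_singleton, Finset.card_univ, Fintype.card_bool,
        one_mul] at h
    · rw [Finset.card_range, nsmul_eq_mul]
  refine ⟨fun z => (matchProduct L p N z).toReal, ?_, fun z => ENNReal.toReal_nonneg, ?_,
    unitSquare \ (B₁ ∪ B₂), sdiff_subset, ?_, ?_, ?_⟩
  · refine memLp_top_of_bound hfm.ennreal_toReal.aestronglyMeasurable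
      (((2 : ℝ≥0∞) ^ L) ^ (blockIndices N).card).toReal (.of_forall fun z => ?_)
    rw [Real.norm_of_nonneg ENNReal.toReal_nonneg]
    exact ENNReal.toReal_mono (by finiteness) (prod_matchWeight_le L _ _ _ z)
  · rw [eLpNorm_one_eq_lintegral_enorm]
    simp only [Real.enorm_of_nonneg ENNReal.toReal_nonneg, ENNReal.ofReal_toReal (hft _).ne]
    exact (lintegral_unitSquare_prod_matchWeight L _ _ _ (fun q _ q' _ => blockStart_separated hp)
      fun q hq q' hq' =>
        partnerStart_separated hp (mem_blockIndices.1 hq) (mem_blockIndices.1 hq')).le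
  · exact (measurableSet_Ico.prod measurableSet_Ico).diff (hB₁m.union hB₂m)
  · have hB : volume.restrict unitSquare (B₁ ∪ B₂) ≤ ENNReal.ofReal ε :=
      (measure_union_le _ _).trans ((add_le_add hB₁.le hB₂).trans hmeas)
    have hdiff := le_measure_sdiff (μ := volume.restrict unitSquare) (s₁ := univ) (s₂ := B₁ ∪ B₂)
    rw [Measure.restrict_apply_univ, volume_unitSquare,
      Measure.restrict_apply (MeasurableSet.univ.diff (hB₁m.union hB₂m)), ← compl_eq_univ_sdiff,
      inter_comm, ← Set.sdiff_eq] at hdiff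
    rw [ENNReal.ofReal_sub _ hε.le, ENNReal.ofReal_one]
    exact (tsub_le_tsub_left hB 1).trans hdiff
  · rintro z ⟨hz, hzB⟩
    rw [mem_union, not_or] at hzB
    constructor
    · have h₁ : ¬ ∀ k ∈ Finset.range N, digitBlock L (blockStart L p (k, false)) z.1 ≠
        digitBlock L (partnerStart L p N (k, false)) z.2 := hzB.1
      push Not at h₁
      obtain ⟨k, hk, hmatch⟩ := h₁
      obtain ⟨i, hi, hzi⟩ := exists_mem_dyadicInterval hz.1 (p k + L)
      obtain ⟨j, hj, hzj⟩ := exists_mem_dyadicInterval hz.2 (p (N - 1 - k) + L)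
      refine ⟨_, ⟨_, hpD k, _, hpD (N - 1 - k), i, hi, j, hj, rfl⟩, ?_⟩
      rw [dyadicRectangle_eq_prod hi.1 hj.1, average_matchProduct_midpoint hL hp
        (Finset.mem_range.1 hk) ⟨hzi, hzj⟩ hmatch]
      exact ⟨⟨hzi, hzj⟩, hM⟩
    · rintro R ⟨c, hc, d, hd, i, hi, j, hj, rfl⟩ hzR
      rw [dyadicRectangle_eq_prod hi.1 hj.1] at hzR ⊢
      refine average_matchProduct_le_one hp (fun k => hpC k c hc) (fun k => hpC k d hd) hL hzR
        fun k hk hall => hzB.2 ?_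
      exact mem_biUnion (Finset.mem_coe.2 (Finset.mem_range.2 hk)) hall
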